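/- Let $H$ be a complex Hilbert space and let $\rho_y$ be a family of states (density operators) on $H$, defined for $y\in\mathbb R^n$ and for instance pure, $\rho_y=|\Psi_y\rangle\langle\Psi_y|$. Let $x\in\mathbb R^n$ and let $L_1,\dots,L_n$ be bounded self-adjoint symmetric logarithmic derivatives at $x$, that is, $\partial_{x_j}\rho_x=\frac12(\rho_xL_j+L_j\rho_x)$, where it is enough that the partial derivative exists weakly, i.e. for $\mathrm{Tr}(A\rho_y)$ with every bounded operator $A$. (For differentiable families of pure states, and if $\dim H<\infty$, boundedness is no restriction.) Let $F_Q$ and $F_{\mathrm{Im}}$ be the real $n\times n$ matrices $$(F_Q)_{jk}=\tfrac12\mathrm{Tr}(\rho_x\{L_j,L_k\}),\qquad (F_{\mathrm{Im}})_{jk}=\tfrac1{2i}\mathrm{Tr}(\rho_x[L_j,L_k]),$$ the quantum Fisher information matrix and the imaginary part of the quantum geometric tensor $\mathrm{Tr}(\rho_xL_jL_k)$, and assume that $F_Q$ is invertible. For a POVM $\{M_m\ge0\mid\sum_mM_m=I\}$ put $p(m|y)=\mathrm{Tr}(M_m\rho_y)$ and let $$(F_C)_{jk}=\sum_{m:\,p(m|x)\ne0}\frac{\partial_{x_j}p(m|x)\,\partial_{x_k}p(m|x)}{p(m|x)}$$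 be the classical Fisher information matrix, and put $$\Gamma=\sup_{\{M_m\}}\mathrm{Tr}(F_Q^{-1}F_C),$$ the supremum being over all POVMs. Let $\lambda_1,\dots,\lambda_n\in\mathbb C$ be the eigenvalues of $F_Q^{-1/2}F_{\mathrm{Im}}F_Q^{-1/2}$, with multiplicity. Then $|\lambda_q|\le1$ for all $q$, the series defining $F_C$ converges absolutely for every POVM, $\Gamma$ is finite, and $$\Gamma\le n-\frac12\sum_{q=1}^n\Bigl(1-\sqrt{1-|\lambda_q|^2}\Bigr).$$ -/

import Mathlib

open scoped InnerProductSpace Topology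

namespace QEst

noncomputable section

/-- The index set of a fixed Hilbert basis of `H`. -/
def basisIndex (H : Type*) [NormedAddCommGroup H] [InnerProductSpace ℂ H] [CompleteSpace H] :
    Set H :=
  (exists_hilbertBasis ℂ H).choose

/-- A fixed Hilbert (complete orthonormal) basis of `H`. -/
def fixedBasis (H : Type*) [NormedAddCommGroup H] [InnerProductSpace ℂ H] [CompleteSpace H] :
    HilbertBasis (basisIndex H) ℂ H :=
  (exists_hilbertBasis ℂ H).choose_spec.choose

section

variable {H : Type*} [NormedAddCommGroup H] [InnerProductSpace ℂ H] [CompleteSpace H]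

/-- The trace `Tr T = ∑ i, ⟪b i, T (b i)⟫`. It is applied only to products of a density operator
with bounded operators; these are trace class, so that the series converges absolutely and does
not depend on the basis. -/
def trace (T : H →L[ℂ] H) : ℂ :=
  ∑' i, ⟪fixedBasis H i, T (fixedBasis H i)⟫_ℂ

/-- Density operators (pure or mixed states): positive operators of trace one. -/
structure IsDensityOperator (ρ : H →L[ℂ] H) : Prop where
  isPositive : ρ.IsPositive
  hasSum_one : HasSum (fun i => ⟪fixedBasis H i, ρ (fixedBasis H i)⟫_ℂ) 1

/-- The operator `|Ψ⟩⟨Ψ|`. -/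
def pureState (Ψ : H) : H →L[ℂ] H := InnerProductSpace.rankOne ℂ Ψ Ψ

variable {n : ℕ}

/-- `L` is a symmetric logarithmic derivative of the family `ρ` for the `j`-th parameter at `x`:
a bounded self-adjoint operator with `∂ⱼ ρ = (ρ L + L ρ) / 2`. The partial derivative is taken
weakly, that is, after pairing with every bounded operator `A` through `Tr (A ρ)`. This asks less
than differentiability in trace norm, and it is the usual partial derivative if `H` is
finite-dimensional. -/
structure IsSLD (ρ : (Fin n → ℝ) → H →L[ℂ] H) (x : Fin n → ℝ) (j : Fin n) (L : H →L[ℂ] H) :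
    Prop where
  isSelfAdjoint : IsSelfAdjoint L
  hasLineDerivAt : ∀ A : H →L[ℂ] H,
    HasLineDerivAt ℝ (fun y => trace (A * ρ y))
      (trace (A * ((1 / 2 : ℂ) • (ρ x * L + L * ρ x)))) x (Pi.single j 1)

/-- The quantum Fisher information matrix, with entries `Tr (ρ {Lⱼ, Lₖ}) / 2` (real numbers). -/
def qfim (ρ : H →L[ℂ] H) (L : Fin n → H →L[ℂ] H) : Matrix (Fin n) (Fin n) ℝ :=
  Matrix.of fun j k => (1 / 2 * trace (ρ * (L j * L k + L k * L j))).re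

/-- The imaginary part of the quantum geometric tensor `Tr (ρ Lⱼ Lₖ)`, with entries
`Tr (ρ [Lⱼ, Lₖ]) / (2 i)` (real numbers). -/
def geomIm (ρ : H →L[ℂ] H) (L : Fin n → H →L[ℂ] H) : Matrix (Fin n) (Fin n) ℝ :=
  Matrix.of fun j k => (1 / (2 * Complex.I) * trace (ρ * (L j * L k - L k * L j))).re

/-- `F ^ (-1/2)` for a positive definite real matrix `F`, by functional calculus. -/
def invSqrt (F : Matrix (Fin n) (Fin n) ℝ) : Matrix (Fin n) (Fin n) ℝ :=
  cfc (fun t : ℝ => (√t)⁻¹) F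

/-- The matrix `F_Q ^ (-1/2) * F_Im * F_Q ^ (-1/2)`. -/
def normalizedIm (ρ : H →L[ℂ] H) (L : Fin n → H →L[ℂ] H) : Matrix (Fin n) (Fin n) ℝ :=
  invSqrt (qfim ρ L) * geomIm ρ L * invSqrt (qfim ρ L)

end

/-- Positive operator-valued measures with outcomes `m : ι`; the series `∑ M m = I` converges in
the strong operator topology (for finitely many outcomes it is the finite sum). -/
structure POVM (ι : Type*) (H : Type*) [NormedAddCommGroup H] [InnerProductSpace ℂ H]
    [CompleteSpace H] where
  /-- The effects. -/
  effect : ι → H →L[ℂ] H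
  isPositive : ∀ m, (effect m).IsPositive
  hasSum_one : ∀ v, HasSum (fun m => effect m v) v

section

variable {H : Type*} [NormedAddCommGroup H] [InnerProductSpace ℂ H] [CompleteSpace H]
variable {n : ℕ} {ι : Type*}

/-- The probability `p (m | x) = Tr (M m * ρ x)` (a real number). -/
def prob (ρ : (Fin n → ℝ) → H →L[ℂ] H) (M : POVM ι H) (m : ι) (x : Fin n → ℝ) : ℝ :=
  (trace (M.effect m * ρ x)).re

/-- The contribution `∂ⱼ p (m | x) * ∂ₖ p (m | x) / p (m | x)` of the outcome `m` to the classical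
Fisher information; outcomes of probability zero contribute zero. -/
def cfimTerm (ρ : (Fin n → ℝ) → H →L[ℂ] H) (x : Fin n → ℝ) (M : POVM ι H) (j k : Fin n) (m : ι) :
    ℝ :=
  lineDeriv ℝ (prob ρ M m) x (Pi.single j 1) * lineDeriv ℝ (prob ρ M m) x (Pi.single k 1) /
    prob ρ M m x

/-- The classical Fisher information matrix of the measurement `M`. -/
def cfim (ρ : (Fin n → ℝ) → H →L[ℂ] H) (x : Fin n → ℝ) (M : POVM ι H) :
    Matrix (Fin n) (Fin n) ℝ :=
  Matrix.of fun j k => ∑' m, cfimTerm ρ x M j k m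

/-- All values of the weighted Fisher information `Tr (F_Q⁻¹ F_C)`, over all POVMs. -/
def weightedInfoValues (ρ : (Fin n → ℝ) → H →L[ℂ] H) (x : Fin n → ℝ) (L : Fin n → H →L[ℂ] H) :
    Set ℝ :=
  {g | ∃ (ι : Type) (M : POVM ι H), g = ((qfim (ρ x) L)⁻¹ * cfim ρ x M).trace}

/-- The maximal (supremal) weighted Fisher information `Γ`. -/
def maxWeightedInfo (ρ : (Fin n → ℝ) → H →L[ℂ] H) (x : Fin n → ℝ) (L : Fin n → H →L[ℂ] H) : ℝ :=
  sSup (weightedInfoValues ρ x L)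

end

section
variable {H : Type*} [NormedAddCommGroup H] [InnerProductSpace ℂ H] [CompleteSpace H]

theorem trace_rankOne (u v : H) :
    trace (InnerProductSpace.rankOne ℂ u v) = ⟪v, u⟫_ℂ := by
  rw [trace, ← (fixedBasis H).tsum_inner_mul_inner v u]
  refine tsum_congr fun i => ?_
  simp

/-- Unit vectors define density operators. -/
theorem isDensityOperator_pureState {Ψ : H} (h : ‖Ψ‖ = 1) : IsDensityOperator (pureState Ψ) := by
  refine ⟨InnerProductSpace.isPositive_rankOne_self Ψ, ?_⟩
  have := (fixedBasis H).hasSum_inner_mul_inner Ψ Ψ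
  rw [inner_self_eq_norm_sq_to_K, h] at this
  simpa [pureState, inner_smul_right] using this

theorem trace_mul_rankOne (A : H →L[ℂ] H) (u v : H) :
    trace (A * InnerProductSpace.rankOne ℂ u v) = ⟪v, A u⟫_ℂ := by
  rw [← trace_rankOne]
  congr 1
  ext w
  simp

/-- A differentiable family of pure states has symmetric logarithmic derivatives. -/
theorem exists_isSLD_pureState {n : ℕ} {Ψ : (Fin n → ℝ) → H} {x : Fin n → ℝ}
    (h : ∀ᶠ y in 𝓝 x, ‖Ψ y‖ = 1) (hd : DifferentiableAt ℝ Ψ x) (j : Fin n) :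
    ∃ L, IsSLD (fun y => pureState (Ψ y)) x j L := by
  set e : Fin n → ℝ := Pi.single j 1
  set D : H := fderiv ℝ Ψ x e with hD
  have hline : HasLineDerivAt ℝ Ψ D x e := hd.hasFDerivAt.hasLineDerivAt e
  have h1 : ‖Ψ x‖ = 1 := h.self_of_nhds
  have hN : ⟪Ψ x, D⟫_ℂ + ⟪D, Ψ x⟫_ℂ = 0 := by
    have a : HasDerivAt (fun t : ℝ => ⟪Ψ (x + t • e), Ψ (x + t • e)⟫_ℂ)
        (⟪Ψ (x + (0 : ℝ) • e), D⟫_ℂ + ⟪D, Ψ (x + (0 : ℝ) • e)⟫_ℂ) 0 :=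
      HasDerivAt.inner ℂ hline hline
    have b : HasDerivAt (fun t : ℝ => ⟪Ψ (x + t • e), Ψ (x + t • e)⟫_ℂ) 0 0 := by
      refine (hasDerivAt_const (0 : ℝ) (1 : ℂ)).congr_of_eventuallyEq ?_
      have hc : Filter.Tendsto (fun t : ℝ => x + t • e) (𝓝 0) (𝓝 x) := by
        have : Continuous (fun t : ℝ => x + t • e) := by fun_prop
        simpa using this.tendsto 0
      filter_upwards [hc.eventually h] with t ht
      rw [inner_self_eq_norm_sq_to_K, ht]; simp
    simpa using a.unique b
  refine ⟨(2 : ℂ) • (InnerProductSpace.rankOne ℂ D (Ψ x) + InnerProductSpace.rankOne ℂ (Ψ x) D),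
    ?_, fun A => ?_⟩
  · rw [isSelfAdjoint_iff, star_smul, star_add]
    simp [ContinuousLinearMap.star_eq_adjoint, add_comm]
  · have key : A * ((1 / 2 : ℂ) • (pureState (Ψ x) *
        ((2 : ℂ) • (InnerProductSpace.rankOne ℂ D (Ψ x) + InnerProductSpace.rankOne ℂ (Ψ x) D)) +
        ((2 : ℂ) • (InnerProductSpace.rankOne ℂ D (Ψ x) + InnerProductSpace.rankOne ℂ (Ψ x) D)) *
          pureState (Ψ x))) =
        InnerProductSpace.rankOne ℂ (A D) (Ψ x) + InnerProductSpace.rankOne ℂ (A (Ψ x)) D := by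
      ext w
      simp [pureState, h1, inner_smul_right, inner_add_right, smul_add, add_smul, smul_smul]
      have hN' : ⟪D, Ψ x⟫_ℂ = -⟪Ψ x, D⟫_ℂ := by linear_combination hN
      rw [hN']
      module
    have htr : trace (InnerProductSpace.rankOne ℂ (A D) (Ψ x) +
        InnerProductSpace.rankOne ℂ (A (Ψ x)) D) = ⟪Ψ x, A D⟫_ℂ + ⟪D, A (Ψ x)⟫_ℂ := by
      have a := ((fixedBasis H).hasSum_inner_mul_inner (Ψ x) (A D)).add
        ((fixedBasis H).hasSum_inner_mul_inner D (A (Ψ x)))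
      rw [trace, ← a.tsum_eq]
      refine tsum_congr fun i => ?_
      simp
    rw [key, htr]
    have a : HasDerivAt (fun t : ℝ => ⟪Ψ (x + t • e), A (Ψ (x + t • e))⟫_ℂ)
        (⟪Ψ (x + (0 : ℝ) • e), A D⟫_ℂ + ⟪D, A (Ψ (x + (0 : ℝ) • e))⟫_ℂ) 0 :=
      HasDerivAt.inner ℂ hline ((A.restrictScalars ℝ).hasFDerivAt.comp_hasDerivAt _ hline)
    simpa [HasLineDerivAt, pureState, trace_mul_rankOne] using a

/-- In finite dimension the trace is the usual one. -/
theorem trace_eq_linearMap_trace [FiniteDimensional ℂ H] (T : H →L[ℂ] H) :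
    trace T = LinearMap.trace ℂ H T.toLinearMap := by
  have : Finite (basisIndex H) :=
    (fixedBasis H).orthonormal.linearIndependent.finite
  have := Fintype.ofFinite (basisIndex H)
  rw [LinearMap.trace_eq_sum_inner _ (fixedBasis H).toOrthonormalBasis, trace, tsum_fintype]
  simp
end

end

end QEst

/-! Write φ(T) = Tr(ρ_x T) and normalise the logarithmic derivatives to K = F_Q^{-1/2} L. Then φ(K_j
K_k) = δ_jk + i A_jk with A = F_Q^{-1/2} F_Im F_Q^{-1/2} real antisymmetric, so iA is Hermitian,
with eigenvalues μ_q and a unitary eigenvector matrix V. The eigenvalues of A are -i μ_q, so |λ_q|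
and |μ_q| agree as multisets.

Since ∂_j p(m|x) = Re φ(M_m L_j), the trace of F_Q⁻¹ F_C is Σ_m |d_m|² / p_m with d_m the real
vector (Re φ(M_m K_j))_j. Its length may be computed in the complex eigenbasis, where the q-th
coordinate is half of φ(M_m X_q) + conj φ(M_m Y_q), with X_q = Σ_j V_jq K_j and Y_q = Σ_j conj(V_jq)
K_j. Here φ(X_q* X_q) = 1 + μ_q and φ(Y_q* Y_q) = 1 - μ_q. Positivity of both gives |μ_q| ≤ 1.

Cauchy–Schwarz and Σ M_m = I give Σ_m |φ(M_m X)|² / p_m ≤ φ(X* X)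
(`sum_norm_map_effect_mul_sq_div_le`). Minkowski's inequality (`sum_norm_add_sq_div_le`) then bounds
the q-th contribution by (√(1+μ_q) + √(1-μ_q))² / 4 = 1 - (1 - √(1-μ_q²)) / 2, and summing over q
gives the claim (`sum_sum_sq_div_le`). -/

namespace QEst

open ComplexConjugate ContinuousLinearMap

section

/-! ### Hilbert–Schmidt operators. -/

section HilbertSchmidt

variable {H : Type*} [NormedAddCommGroup H] [InnerProductSpace ℂ H]
variable {ι : Type*} (b : HilbertBasis ι ℂ H)

theorem hasSum_norm_inner_sq (v : H) : HasSum (fun i => ‖⟪b i, v⟫_ℂ‖ ^ 2) (‖v‖ ^ 2) := by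
  have h := (Complex.hasSum_iff _ _).1 (b.hasSum_inner_mul_inner v v)
  convert h.1 using 1
  · ext i
    rw [← inner_conj_symm v (b i), ← Complex.normSq_eq_conj_mul_self, Complex.normSq_eq_norm_sq]
    norm_cast
  · rw [inner_self_eq_norm_sq_to_K]
    simp [← Complex.ofReal_pow]

theorem summable_prod_norm_inner_sq {X : H →L[ℂ] H} (hX : Summable fun i => ‖X (b i)‖ ^ 2) :
    Summable fun p : ι × ι => ‖⟪b p.2, X (b p.1)⟫_ℂ‖ ^ 2 := by
  rw [summable_prod_of_nonneg fun _ => by positivity]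
  refine ⟨fun i => (hasSum_norm_inner_sq b (X (b i))).summable, ?_⟩
  simpa only [(hasSum_norm_inner_sq b _).tsum_eq] using hX

theorem summable_inner_of_summable_norm_sq {u v : ι → H} (hu : Summable fun i => ‖u i‖ ^ 2)
    (hv : Summable fun i => ‖v i‖ ^ 2) : Summable fun i => ⟪u i, v i⟫_ℂ := by
  refine Summable.of_norm_bounded (hu.add hv) fun i => (norm_inner_le_norm _ _).trans ?_
  nlinarith [sq_nonneg (‖u i‖ - ‖v i‖), sq_nonneg ‖u i‖, sq_nonneg ‖v i‖]

variable [CompleteSpace H]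

/-- By Parseval both sums add up the squared moduli of all matrix entries, once by columns and once
by rows. -/
theorem summable_norm_adjoint_sq {X : H →L[ℂ] H} (hX : Summable fun i => ‖X (b i)‖ ^ 2) :
    Summable fun i => ‖adjoint X (b i)‖ ^ 2 := by
  have h := (summable_prod_norm_inner_sq b hX).prod_symm.prod
  refine h.congr fun i => ?_
  rw [← (hasSum_norm_inner_sq b (adjoint X (b i))).tsum_eq]
  refine tsum_congr fun j => ?_
  rw [adjoint_inner_right, norm_inner_symm]
  rfl

/-- The Hilbert–Schmidt inner product is invariant under passing to adjoints. -/
theorem tsum_inner_adjoint {X Y : H →L[ℂ] H} (hX : Summable fun i => ‖X (b i)‖ ^ 2)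
    (hY : Summable fun i => ‖Y (b i)‖ ^ 2) :
    ∑' i, ⟪X (b i), Y (b i)⟫_ℂ = ∑' i, ⟪adjoint Y (b i), adjoint X (b i)⟫_ℂ := by
  have hs : Summable (Function.uncurry fun i j => ⟪X (b i), b j⟫_ℂ * ⟪b j, Y (b i)⟫_ℂ) := by
    refine Summable.of_norm_bounded
      ((summable_prod_norm_inner_sq b hX).add (summable_prod_norm_inner_sq b hY)) ?_
    rintro ⟨i, j⟩
    change ‖⟪X (b i), b j⟫_ℂ * ⟪b j, Y (b i)⟫_ℂ‖ ≤ ‖⟪b j, X (b i)⟫_ℂ‖ ^ 2 + ‖⟪b j, Y (b i)⟫_ℂ‖ ^ 2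
    rw [norm_mul, norm_inner_symm]
    generalize ‖⟪b j, X (b i)⟫_ℂ‖ = s
    generalize ‖⟪b j, Y (b i)⟫_ℂ‖ = t
    nlinarith [sq_nonneg (s - t), sq_nonneg s, sq_nonneg t]
  calc ∑' i, ⟪X (b i), Y (b i)⟫_ℂ
      = ∑' i, ∑' j, ⟪X (b i), b j⟫_ℂ * ⟪b j, Y (b i)⟫_ℂ :=
        tsum_congr fun i => (b.tsum_inner_mul_inner _ _).symm
    _ = ∑' j, ∑' i, ⟪X (b i), b j⟫_ℂ * ⟪b j, Y (b i)⟫_ℂ := hs.tsum_comm.symm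
    _ = ∑' i, ⟪adjoint Y (b i), adjoint X (b i)⟫_ℂ := by
        refine tsum_congr fun j => ?_
        rw [← b.tsum_inner_mul_inner]
        refine tsum_congr fun i => ?_
        rw [adjoint_inner_left, adjoint_inner_right, mul_comm]

/-- Passing to adjoints turns right multiplication into left multiplication, where the operator norm
bound applies term by term. -/
theorem summable_norm_mul_sq {X : H →L[ℂ] H} (hX : Summable fun i => ‖X (b i)‖ ^ 2)
    (A : H →L[ℂ] H) : Summable fun i => ‖(X * A) (b i)‖ ^ 2 := by
  have h : Summable fun i => ‖(adjoint A * adjoint X) (b i)‖ ^ 2 := by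
    refine Summable.of_nonneg_of_le (fun _ => by positivity) (fun i => ?_)
      ((summable_norm_adjoint_sq b hX).mul_left (‖adjoint A‖ ^ 2))
    rw [← mul_pow]
    exact pow_le_pow_left₀ (norm_nonneg _) ((adjoint A).le_opNorm _) 2
  have h' := summable_norm_adjoint_sq b h
  have e : adjoint (adjoint A * adjoint X) = X * A := by
    simp only [← star_eq_adjoint, star_mul, star_star]
  rwa [e] at h'

end HilbertSchmidt

/-! ### The expectation functional of a state. -/

variable {H : Type*} [NormedAddCommGroup H] [InnerProductSpace ℂ H] [CompleteSpace H]

/-- `φ` is the expectation functional `A ↦ Tr (ρ A)` of the positive trace class operator `ρ`. -/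
structure IsExpectation (ρ : H →L[ℂ] H) (φ : (H →L[ℂ] H) →ₗ[ℂ] ℂ) : Prop where
  hasSum : ∀ A B, HasSum (fun i => ⟪fixedBasis H i, (A * ρ * B) (fixedBasis H i)⟫_ℂ) (φ (B * A))
  re_nonneg : ∀ T : H →L[ℂ] H, T.IsPositive → 0 ≤ (φ T).re
  map_star : ∀ T, φ (star T) = conj (φ T)

/-- Factor ρ = S² with S = √ρ, which is Hilbert–Schmidt because Tr ρ converges, and take φ(A) = Σ ⟨S
b_i, A S b_i⟩. Cyclicity of the trace becomes adjoint invariance of the Hilbert–Schmidt inner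
product of S A* and S B. -/
theorem IsDensityOperator.exists_isExpectation {ρ : H →L[ℂ] H} (hρ : IsDensityOperator ρ) :
    ∃ φ, IsExpectation ρ φ := by
  set b := fixedBasis H
  have h0 : 0 ≤ ρ := (nonneg_iff_isPositive ρ).2 hρ.isPositive
  set S : H →L[ℂ] H := CFC.sqrt ρ
  have hSS : S * S = ρ := CFC.sqrt_mul_sqrt_self ρ
  have hSpos : S.IsPositive := (nonneg_iff_isPositive S).1 (CFC.sqrt_nonneg ρ)
  have hSa : adjoint S = S := hSpos.isSelfAdjoint.adjoint_eq
  have hS : Summable fun i => ‖S (b i)‖ ^ 2 := by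
    refine ((Complex.hasSum_iff _ _).1 hρ.hasSum_one).1.summable.congr fun i => ?_
    have e : ⟪b i, ρ (b i)⟫_ℂ = ⟪S (b i), S (b i)⟫_ℂ := by
      rw [← hSS, mul_apply_eq_comp, ← adjoint_inner_left, hSa]
    rw [e, inner_self_eq_norm_sq_to_K]
    simp [← Complex.ofReal_pow]
  have hA (A : H →L[ℂ] H) : Summable fun i => ‖A (S (b i))‖ ^ 2 := by
    refine Summable.of_nonneg_of_le (fun _ => by positivity) (fun i => ?_) (hS.mul_left (‖A‖ ^ 2))
    rw [← mul_pow]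
    gcongr
    exact le_opNorm _ _
  have hsum (A : H →L[ℂ] H) : Summable fun i => ⟪S (b i), A (S (b i))⟫_ℂ :=
    summable_inner_of_summable_norm_sq hS (hA A)
  refine ⟨{ toFun := fun A => ∑' i, ⟪S (b i), A (S (b i))⟫_ℂ
            map_add' := fun A B => ?_
            map_smul' := fun c A => ?_ }, ⟨fun A B => ?_, fun T hT => ?_, fun T => ?_⟩⟩
  · rw [← (hsum A).tsum_add (hsum B)]
    simp
  · simp only [_root_.smul_apply, inner_smul_right, RingHom.id_apply, smul_eq_mul]
    exact tsum_mul_left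
  · have hX := summable_norm_mul_sq b hS (adjoint A)
    have hY := summable_norm_mul_sq b hS B
    have e : (fun i => ⟪b i, (A * ρ * B) (b i)⟫_ℂ) =
        fun i => ⟪(S * adjoint A) (b i), (S * B) (b i)⟫_ℂ := by
      ext i
      rw [← hSS]
      simp only [mul_apply_eq_comp]
      rw [← adjoint_inner_left, ← adjoint_inner_left, hSa]
    rw [e]
    convert (summable_inner_of_summable_norm_sq hX hY).hasSum using 1
    rw [tsum_inner_adjoint b hX hY]
    refine tsum_congr fun i => ?_
    have e1 : adjoint (S * B) = adjoint B * S := by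
      rw [← star_eq_adjoint, star_mul, star_eq_adjoint, star_eq_adjoint, hSa]
    have e2 : adjoint (S * adjoint A) = A * S := by
      rw [← star_eq_adjoint, star_mul, star_eq_adjoint, star_eq_adjoint, hSa, adjoint_adjoint]
    rw [e1, e2]
    simp only [mul_apply_eq_comp]
    rw [adjoint_inner_left]
  · change 0 ≤ (∑' i, ⟪S (b i), T (S (b i))⟫_ℂ).re
    rw [Complex.re_tsum (hsum T)]
    exact tsum_nonneg fun i => hT.re_inner_nonneg_right _
  · change ∑' i, ⟪S (b i), star T (S (b i))⟫_ℂ = conj (∑' i, ⟪S (b i), T (S (b i))⟫_ℂ)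
    rw [Complex.conj_tsum]
    refine tsum_congr fun i => ?_
    rw [inner_conj_symm, star_eq_adjoint, adjoint_inner_right]

/-! ### Cauchy–Schwarz bounds for measurements. -/

namespace IsExpectation

variable {ρ : H →L[ℂ] H} {φ : (H →L[ℂ] H) →ₗ[ℂ] ℂ} (hφ : IsExpectation ρ φ)
include hφ

theorem trace_mul_left (A : H →L[ℂ] H) : trace (A * ρ) = φ A := by
  simpa [trace] using (hφ.hasSum A 1).tsum_eq

theorem trace_mul_right (A : H →L[ℂ] H) : trace (ρ * A) = φ A := by
  simpa [trace] using (hφ.hasSum 1 A).tsum_eq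

/-- Cauchy–Schwarz for the positive semidefinite form (A, B) ↦ φ(A* M B), applied to 1 and X. -/
theorem norm_map_mul_sq_le {M : H →L[ℂ] H} (hM : M.IsPositive) (X : H →L[ℂ] H) :
    ‖φ (M * X)‖ ^ 2 ≤ (φ M).re * (φ (star X * M * X)).re := by
  have hMs : star M = M := hM.isSelfAdjoint.star_eq
  let c : PreInnerProductSpace.Core ℂ (H →L[ℂ] H) :=
    { inner := fun A B => φ (star A * M * B)
      conj_inner_symm := fun A B => by
        rw [← hφ.map_star]
        simp [hMs, mul_assoc]
      re_inner_nonneg := fun A => by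
        refine hφ.re_nonneg _ ?_
        simpa [star_eq_adjoint, ContinuousLinearMap.mul_def, comp_assoc] using hM.adjoint_conj A
      add_left := fun A B C => by simp [add_mul]
      smul_left := fun A B r => by simp }
  have h := @InnerProductSpace.Core.inner_mul_inner_self_le ℂ (H →L[ℂ] H) _ _ _ c 1 X
  have e : ‖φ (star X * M)‖ = ‖φ (M * X)‖ := by
    rw [show star X * M = star (M * X) by simp [hMs], hφ.map_star, RCLike.norm_conj]
  have h' : ‖φ (star 1 * M * X)‖ * ‖φ (star X * M * 1)‖ ≤
    (φ (star 1 * M * 1)).re * (φ (star X * M * X)).re := h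
  simpa [e, ← sq] using h'

/-- Each quotient is at most φ(X* M_m X), also for p_m = 0, where it is zero by convention. The rest
X* (1 - Σ_s M_m) X is positive. -/
theorem sum_norm_map_effect_mul_sq_div_le {ι : Type*} (M : POVM ι H) (X : H →L[ℂ] H)
    (s : Finset ι) :
    ∑ m ∈ s, ‖φ (M.effect m * X)‖ ^ 2 / (φ (M.effect m)).re ≤ (φ (star X * X)).re := by
  have h1 : ∑ m ∈ s, ‖φ (M.effect m * X)‖ ^ 2 / (φ (M.effect m)).re ≤
      ∑ m ∈ s, (φ (star X * M.effect m * X)).re := by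
    refine Finset.sum_le_sum fun m _ => ?_
    refine div_le_of_le_mul₀ (hφ.re_nonneg _ (M.isPositive m)) (hφ.re_nonneg _ ?_) ?_
    · simpa [star_eq_adjoint, ContinuousLinearMap.mul_def, comp_assoc] using
        (M.isPositive m).adjoint_conj X
    · rw [mul_comm]
      exact hφ.norm_map_mul_sq_le (M.isPositive m) X
  have hpos : (1 - ∑ m ∈ s, M.effect m).IsPositive := by
    refine isPositive_def'.2 ⟨?_, fun v => ?_⟩
    · exact (IsSelfAdjoint.one _).sub (isSelfAdjoint_sum _ fun m _ => (M.isPositive m).isSelfAdjoint)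
    -- Strong convergence of Σ M_m = I is needed only in this weak form: a partial sum of
    -- nonnegative numbers is at most ‖v‖².
    · have hs : HasSum (fun m => (⟪M.effect m v, v⟫_ℂ).re) (⟪v, v⟫_ℂ).re :=
        Complex.hasSum_re <| by
          have := (innerSL ℂ v).hasSum (M.hasSum_one v)
          have := Complex.hasSum_conj'.2 this
          simpa [inner_conj_symm] using this
      have hle := sum_le_hasSum s (fun m _ => (M.isPositive m).re_inner_nonneg_left v) hs
      simp only [reApplyInnerSelf, _root_.sub_apply, one_apply_eq_self, sum_apply, inner_sub_left,
        sum_inner, map_sub, map_sum]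
      simpa using hle
  have h2 := hφ.re_nonneg (star X * (1 - ∑ m ∈ s, M.effect m) * X) (by
    simpa [star_eq_adjoint, ContinuousLinearMap.mul_def, comp_assoc] using hpos.adjoint_conj X)
  have e : star X * (1 - ∑ m ∈ s, M.effect m) * X =
      star X * X - ∑ m ∈ s, star X * M.effect m * X := by
    rw [mul_sub, sub_mul, mul_one, Finset.mul_sum, Finset.sum_mul]
  rw [e, map_sub, map_sum, Complex.sub_re, Complex.re_sum] at h2
  linarith

end IsExpectation

end

/-! ### Inverse square root, spectrum and unitary invariance. -/

section Matrices

variable {n : ℕ}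

theorem transpose_invSqrt (F : Matrix (Fin n) (Fin n) ℝ) : (invSqrt F).transpose = invSqrt F := by
  have h : IsSelfAdjoint (invSqrt F) := cfc_predicate _ _
  simpa [isSelfAdjoint_iff, Matrix.star_eq_conjTranspose] using h

/-- The identity t^{-1/2} t^{-1/2} t = 1 is checked on the spectrum, which is positive by
semidefiniteness and invertibility, and finite, so that continuity is automatic. -/
theorem invSqrt_mul_invSqrt {F : Matrix (Fin n) (Fin n) ℝ} (hF : F.PosSemidef) (hu : IsUnit F) :
    invSqrt F * invSqrt F = F⁻¹ := by
  have hs : IsSelfAdjoint F := hF.isHermitian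
  have hc (f : ℝ → ℝ) : ContinuousOn f (spectrum ℝ F) :=
    (Matrix.finite_real_spectrum (A := F)).continuousOn f
  have hmem : ∀ t ∈ spectrum ℝ F, 0 < t := fun t ht =>
    lt_of_le_of_ne ((Matrix.posSemidef_iff_isHermitian_and_spectrum_nonneg.1 hF).2 ht)
      (fun h => spectrum.zero_notMem ℝ hu (h ▸ ht))
  refine (Matrix.inv_eq_left_inv ?_).symm
  calc invSqrt F * invSqrt F * F
      = cfc (fun t : ℝ => (√t)⁻¹ * (√t)⁻¹ * t) F := by
        rw [cfc_mul _ _ F (hc _) (hc _), cfc_mul _ _ F (hc _) (hc _), cfc_id' ℝ F hs, invSqrt]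
    _ = cfc (1 : ℝ → ℝ) F := cfc_congr fun t ht => by
        have h0 := hmem t ht
        have h1 : √t ≠ 0 := (Real.sqrt_pos.2 h0).ne'
        simp only [Pi.one_apply]
        field_simp
        exact (Real.sq_sqrt h0.le).symm
    _ = 1 := cfc_one ℝ F hs

/-- The eigenvalues of a real matrix `A` for which `i A` is Hermitian. -/
theorem roots_charpoly_of_isHermitian_I_smul {A : Matrix (Fin n) (Fin n) ℝ}
    (h : (Complex.I • A.map Complex.ofReal).IsHermitian) :
    (A.map Complex.ofReal).charpoly.roots =
      Finset.univ.val.map fun q => -Complex.I * (h.eigenvalues q : ℂ) := by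
  generalize A.map Complex.ofReal = B at h ⊢
  have e : B = (h.eigenvectorUnitary : Matrix (Fin n) (Fin n) ℂ) *
      Matrix.diagonal (fun q => -Complex.I * (h.eigenvalues q : ℂ)) *
        star (h.eigenvectorUnitary : Matrix (Fin n) (Fin n) ℂ) := by
    have h1 := h.spectral_theorem
    rw [Unitary.conjStarAlgAut_apply] at h1
    have h2 : B = (-Complex.I) • (Complex.I • B) := by simp [smul_smul]
    have h3 : Matrix.diagonal (fun q => -Complex.I * (h.eigenvalues q : ℂ)) =
        (-Complex.I) • Matrix.diagonal (RCLike.ofReal ∘ h.eigenvalues) := by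
      rw [← Matrix.diagonal_smul]
      rfl
    rw [h3, Matrix.mul_smul, Matrix.smul_mul]
    exact h2.trans (congrArg _ h1)
  rw [congrArg Matrix.charpoly e, Matrix.charpoly_mul_comm, ← mul_assoc, Unitary.coe_star_mul_self, one_mul,
    Matrix.charpoly_diagonal, Polynomial.roots_prod _ _
      (Finset.prod_ne_zero_iff.2 fun q _ => Polynomial.X_sub_C_ne_zero _)]
  simp only [Polynomial.roots_X_sub_C]
  exact Multiset.bind_singleton _ _

theorem map_norm_eq_of_map_eq_roots {A : Matrix (Fin n) (Fin n) ℝ}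
    (h : (Complex.I • A.map Complex.ofReal).IsHermitian) {ev : Fin n → ℂ}
    (hev : Finset.univ.val.map ev = (A.map Complex.ofReal).charpoly.roots) :
    (Finset.univ.val.map fun q => ‖ev q‖) = Finset.univ.val.map fun q => |h.eigenvalues q| := by
  rw [roots_charpoly_of_isHermitian_I_smul h] at hev
  have := congrArg (Multiset.map fun z : ℂ => ‖z‖) hev
  simpa [Multiset.map_map, Function.comp_def] using this

/-- The squared norm of a real vector in a complex orthonormal basis. -/
theorem sum_norm_sum_mul_sq (U : Matrix.unitaryGroup (Fin n) ℂ) (d : Fin n → ℝ) :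
    ∑ q, ‖∑ j, (U : Matrix (Fin n) (Fin n) ℂ) j q * (d j : ℂ)‖ ^ 2 = ∑ j, d j ^ 2 := by
  have hU : (U : Matrix (Fin n) (Fin n) ℂ) * star (U : Matrix (Fin n) (Fin n) ℂ) = 1 :=
    Unitary.coe_mul_star_self U
  set V := (U : Matrix (Fin n) (Fin n) ℂ)
  have hV (j k : Fin n) : ∑ q, V j q * conj (V k q) = if j = k then 1 else 0 := by
    have := congrFun (congrFun hU j) k
    simpa [Matrix.mul_apply, Matrix.one_apply] using this
  rw [← Complex.ofReal_inj]
  push_cast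
  have e (q : Fin n) : (‖∑ j, V j q * (d j : ℂ)‖ : ℂ) ^ 2 =
      ∑ j, ∑ k, (d j : ℂ) * d k * (V j q * conj (V k q)) := by
    rw [← Complex.mul_conj', map_sum, Finset.sum_mul_sum]
    refine Finset.sum_congr rfl fun j _ => Finset.sum_congr rfl fun k _ => ?_
    rw [map_mul, Complex.conj_ofReal]
    ring
  simp only [e]
  rw [Finset.sum_comm]
  refine Finset.sum_congr rfl fun j _ => ?_
  rw [Finset.sum_comm]
  simp [← Finset.mul_sum, hV, sq]

end Matrices

/-- Minkowski's inequality in ℓ² with weights 1 / p_m, squared. Terms with p_m = 0 vanish on both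
sides. -/
theorem sum_norm_add_sq_div_le {ι : Type*} (s : Finset ι) (u v : ι → ℂ) {p : ι → ℝ}
    (hp : ∀ m, 0 ≤ p m) {a b : ℝ} (hu : ∑ m ∈ s, ‖u m‖ ^ 2 / p m ≤ a)
    (hv : ∑ m ∈ s, ‖v m‖ ^ 2 / p m ≤ b) :
    ∑ m ∈ s, ‖u m + v m‖ ^ 2 / p m ≤ a + b + 2 * (√a * √b) := by
  have hu' (m : ι) : 0 ≤ ‖u m‖ ^ 2 / p m := div_nonneg (sq_nonneg _) (hp m)
  have hv' (m : ι) : 0 ≤ ‖v m‖ ^ 2 / p m := div_nonneg (sq_nonneg _) (hp m)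
  have h1 : ∑ m ∈ s, ‖u m + v m‖ ^ 2 / p m ≤
      ∑ m ∈ s, (‖u m‖ ^ 2 / p m + ‖v m‖ ^ 2 / p m +
        2 * (√(‖u m‖ ^ 2 / p m) * √(‖v m‖ ^ 2 / p m))) := by
    refine Finset.sum_le_sum fun m _ => ?_
    rw [← Real.sqrt_mul (hu' m), div_mul_div_comm, ← mul_pow, ← sq, ← div_pow,
      Real.sqrt_sq (div_nonneg (by positivity) (hp m)), ← add_div, mul_div_assoc', ← add_div]
    gcongr
    · exact hp m
    · have := norm_add_le (u m) (v m)
      nlinarith [norm_nonneg (u m + v m), norm_nonneg (u m), norm_nonneg (v m)]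
  refine h1.trans ?_
  rw [Finset.sum_add_distrib, Finset.sum_add_distrib, ← Finset.mul_sum]
  have h2 := Real.sum_sqrt_mul_sqrt_le s hu' hv'
  have h3 := mul_le_mul (Real.sqrt_le_sqrt hu) (Real.sqrt_le_sqrt hv) (Real.sqrt_nonneg _)
    (Real.sqrt_nonneg _)
  linarith

/-! ### The information bound in normalised coordinates. -/

section

variable {H : Type*} [NormedAddCommGroup H] [InnerProductSpace ℂ H] [CompleteSpace H] {n : ℕ}

namespace IsExpectation

variable {ρ : H →L[ℂ] H} {φ : (H →L[ℂ] H) →ₗ[ℂ] ℂ} (hφ : IsExpectation ρ φ)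

theorem map_star_sum_mul_sum {K : Fin n → H →L[ℂ] H} (hK : ∀ j, IsSelfAdjoint (K j))
    (c : Fin n → ℂ) :
    φ (star (∑ j, c j • K j) * ∑ j, c j • K j) =
      ∑ j, ∑ k, conj (c j) * φ (K j * K k) * c k := by
  simp only [star_sum, star_smul, (hK _).star_eq, Finset.sum_mul_sum, map_sum, smul_mul_assoc,
    mul_smul_comm, map_smul, smul_eq_mul]
  refine Finset.sum_congr rfl fun j _ => Finset.sum_congr rfl fun k _ => ?_
  simp only [RCLike.star_def]
  ring

include hφ

theorem re_map_star_mul_self_nonneg (X : H →L[ℂ] H) : 0 ≤ (φ (star X * X)).re :=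
  hφ.re_nonneg _ (by simpa [star_eq_adjoint, ContinuousLinearMap.mul_def] using
    isPositive_adjoint_comp_self X)

variable {L : Fin n → H →L[ℂ] H} (hL : ∀ j, IsSelfAdjoint (L j))
include hL

theorem conj_map_mul (j k : Fin n) : conj (φ (L j * L k)) = φ (L k * L j) := by
  rw [← hφ.map_star, star_mul, (hL j).star_eq, (hL k).star_eq]

theorem qfim_apply (j k : Fin n) : qfim ρ L j k = (φ (L j * L k)).re := by
  simp only [qfim, Matrix.of_apply, hφ.trace_mul_right, map_add, ← hφ.conj_map_mul hL j k]
  simp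
  ring

theorem geomIm_apply (j k : Fin n) : geomIm ρ L j k = (φ (L j * L k)).im := by
  simp only [geomIm, Matrix.of_apply, hφ.trace_mul_right, map_sub, ← hφ.conj_map_mul hL j k]
  simp
  ring

theorem map_mul_eq (j k : Fin n) :
    φ (L j * L k) = (qfim ρ L j k : ℂ) + Complex.I * (geomIm ρ L j k : ℂ) := by
  rw [hφ.qfim_apply hL, hφ.geomIm_apply hL, mul_comm, Complex.re_add_im]

theorem transpose_geomIm : (geomIm ρ L).transpose = -geomIm ρ L := by
  ext j k
  rw [Matrix.transpose_apply, Matrix.neg_apply, hφ.geomIm_apply hL, hφ.geomIm_apply hL,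
    ← hφ.conj_map_mul hL, Complex.conj_im]

/-- For real c, the quadratic form at c is the real part of φ(X* X) with X = Σ c_j L_j. -/
theorem posSemidef_qfim : (qfim ρ L).PosSemidef := by
  refine Matrix.PosSemidef.of_dotProduct_mulVec_nonneg ?_ fun c => ?_
  · ext j k
    rw [Matrix.conjTranspose_apply, star_trivial, hφ.qfim_apply hL, hφ.qfim_apply hL,
      ← hφ.conj_map_mul hL, Complex.conj_re]
  · have h := hφ.re_map_star_mul_self_nonneg (∑ j, (c j : ℂ) • L j)
    rw [map_star_sum_mul_sum hL] at h
    refine h.trans_eq ?_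
    simp only [dotProduct, Matrix.mulVec, Pi.star_apply, star_trivial, Complex.re_sum,
      Finset.mul_sum, Complex.conj_ofReal, Complex.re_mul_ofReal, Complex.re_ofReal_mul,
      hφ.qfim_apply hL, mul_assoc]

/-- Real linear combinations of the operators `L k` transform the matrix `Tr (ρ Lⱼ Lₖ)` by
congruence. -/
theorem map_sum_smul_mul_sum_smul (R : Matrix (Fin n) (Fin n) ℝ) (j k : Fin n) :
    φ ((∑ a, (R j a : ℂ) • L a) * ∑ b, (R k b : ℂ) • L b) =
      ((R * qfim ρ L * R.transpose) j k : ℝ) +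
        Complex.I * ((R * geomIm ρ L * R.transpose) j k : ℝ) := by
  rw [Finset.sum_mul_sum]
  simp only [map_sum, smul_mul_assoc, mul_smul_comm, map_smul, smul_eq_mul,
    hφ.map_mul_eq hL, Matrix.mul_apply, Matrix.transpose_apply, Finset.sum_mul]
  push_cast
  rw [Finset.mul_sum, ← Finset.sum_add_distrib, Finset.sum_comm]
  refine Finset.sum_congr rfl fun b _ => ?_
  rw [Finset.mul_sum, ← Finset.sum_add_distrib]
  refine Finset.sum_congr rfl fun a _ => ?_
  ring

omit hL in
/-- The information bound for operators `K j` with `Tr (ρ Kⱼ Kₖ) = δⱼₖ + i Aⱼₖ`. -/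
theorem sum_sum_sq_div_le {K : Fin n → H →L[ℂ] H} (hK : ∀ j, IsSelfAdjoint (K j))
    {A : Matrix (Fin n) (Fin n) ℝ} (h : (Complex.I • A.map Complex.ofReal).IsHermitian)
    (hA : ∀ j k, φ (K j * K k) = (1 + Complex.I • A.map Complex.ofReal) j k) :
    (∀ q, |h.eigenvalues q| ≤ 1) ∧
    ∀ {ι : Type*} (M : POVM ι H) (s : Finset ι),
      ∑ m ∈ s, (∑ j, (φ (M.effect m * K j)).re ^ 2) / (φ (M.effect m)).re ≤
        n - 1 / 2 * ∑ q, (1 - √(1 - |h.eigenvalues q| ^ 2)) := by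
  set B := Complex.I • A.map Complex.ofReal
  set V := (h.eigenvectorUnitary : Matrix (Fin n) (Fin n) ℂ) with hVdef
  have hV : star V * V = 1 := Unitary.coe_star_mul_self _
  have hBV (q : Fin n) : (star V * B * V) q q = h.eigenvalues q := by
    have h1 := h.spectral_theorem
    rw [Unitary.conjStarAlgAut_apply] at h1
    have h2 : star V * B * V = Matrix.diagonal (RCLike.ofReal ∘ h.eigenvalues) := by
      calc star V * B * V
          = (star V * V) * Matrix.diagonal (RCLike.ofReal ∘ h.eigenvalues) * (star V * V) := by
            conv_lhs => rw [h1]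
            simp only [mul_assoc]
            rfl
        _ = _ := by rw [hV, one_mul, mul_one]
    rw [h2, Matrix.diagonal_apply_eq]
    rfl
  -- `B` is Hermitian with purely imaginary entries, hence antisymmetric. This is what flips the
  -- sign of the eigenvalue when the coefficients are conjugated in `hY`.
  have hBT (j k : Fin n) : B k j = -B j k := by
    rw [← h.apply k j]
    simp [B]
  have hX (q : Fin n) : (φ (star (∑ j, V j q • K j) * ∑ j, V j q • K j)).re =
      1 + h.eigenvalues q := by
    have e : φ (star (∑ j, V j q • K j) * ∑ j, V j q • K j) = (star V * (1 + B) * V) q q := by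
      rw [map_star_sum_mul_sum hK, Finset.sum_comm]
      simp only [Matrix.mul_apply, Finset.sum_mul, hA]
      rfl
    rw [e, mul_add, add_mul, mul_one, hV, Matrix.add_apply, hBV, Matrix.one_apply_eq]
    simp
  have hY (q : Fin n) : (φ (star (∑ j, conj (V j q) • K j) * ∑ j, conj (V j q) • K j)).re =
      1 - h.eigenvalues q := by
    have e : φ (star (∑ j, conj (V j q) • K j) * ∑ j, conj (V j q) • K j) =
        (star V * (1 - B) * V) q q := by
      rw [map_star_sum_mul_sum hK]
      simp only [Matrix.mul_apply, Finset.sum_mul, hA]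
      refine Finset.sum_congr rfl fun j _ => Finset.sum_congr rfl fun k _ => ?_
      rw [Matrix.add_apply, Matrix.sub_apply, hBT k j, Matrix.star_apply, RCLike.star_def,
        Matrix.one_apply, Matrix.one_apply]
      simp only [eq_comm (a := j), Complex.conj_conj]
      ring
    rw [e, mul_sub, sub_mul, mul_one, hV, Matrix.sub_apply, hBV, Matrix.one_apply_eq]
    simp
  have habs (q : Fin n) : |h.eigenvalues q| ≤ 1 := by
    rw [abs_le]
    constructor
    · linarith [hX q, hφ.re_map_star_mul_self_nonneg (∑ j, V j q • K j)]
    · linarith [hY q, hφ.re_map_star_mul_self_nonneg (∑ j, conj (V j q) • K j)]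
  refine ⟨habs, fun {ι} M s => ?_⟩
  -- Re z = (z + conj z) / 2; in the second half the conjugation is pulled outside, which conjugates
  -- the coefficients `V j q`.
  have hd (m : ι) (q : Fin n) : ∑ j, V j q * ((φ (M.effect m * K j)).re : ℂ) =
      1 / 2 * (φ (M.effect m * ∑ j, V j q • K j) +
        conj (φ (M.effect m * ∑ j, conj (V j q) • K j))) := by
    simp only [Finset.mul_sum, map_sum, mul_smul_comm, map_smul, smul_eq_mul, map_mul,
      Complex.conj_conj]
    rw [← Finset.sum_add_distrib, Finset.mul_sum]
    refine Finset.sum_congr rfl fun j _ => ?_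
    rw [Complex.re_eq_add_conj]
    ring
  have hq (q : Fin n) : ∑ m ∈ s, ‖∑ j, V j q * ((φ (M.effect m * K j)).re : ℂ)‖ ^ 2 /
      (φ (M.effect m)).re ≤ 1 - 1 / 2 * (1 - √(1 - |h.eigenvalues q| ^ 2)) := by
    have hu := hφ.sum_norm_map_effect_mul_sq_div_le M (∑ j, V j q • K j) s
    have hv := hφ.sum_norm_map_effect_mul_sq_div_le M (∑ j, conj (V j q) • K j) s
    rw [hX] at hu
    rw [hY] at hv
    have hsum := sum_norm_add_sq_div_le s (fun m => φ (M.effect m * ∑ j, V j q • K j))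
      (fun m => conj (φ (M.effect m * ∑ j, conj (V j q) • K j)))
      (fun m => hφ.re_nonneg _ (M.isPositive m)) hu (by simpa only [RCLike.norm_conj] using hv)
    rw [← Real.sqrt_mul (by linarith [(abs_le.1 (habs q)).1])] at hsum
    have e : (1 + h.eigenvalues q) * (1 - h.eigenvalues q) = 1 - |h.eigenvalues q| ^ 2 := by
      rw [sq_abs]
      ring
    rw [e] at hsum
    -- The factor 1/2 enters squared: (1 + μ + 1 - μ + 2√(1 - μ²)) / 4 is the asserted bound.
    simp only [hd, norm_mul, mul_pow, mul_div_assoc, ← Finset.mul_sum]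
    norm_num
    norm_num at hsum
    linarith
  calc ∑ m ∈ s, (∑ j, (φ (M.effect m * K j)).re ^ 2) / (φ (M.effect m)).re
      = ∑ q, ∑ m ∈ s, ‖∑ j, V j q * ((φ (M.effect m * K j)).re : ℂ)‖ ^ 2 /
          (φ (M.effect m)).re := by
        rw [Finset.sum_comm]
        refine Finset.sum_congr rfl fun m _ => ?_
        rw [← sum_norm_sum_mul_sq h.eigenvectorUnitary, Finset.sum_div]
    _ ≤ ∑ q, (1 - 1 / 2 * (1 - √(1 - |h.eigenvalues q| ^ 2))) := Finset.sum_le_sum fun q _ => hq q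
    _ = n - 1 / 2 * ∑ q, (1 - √(1 - |h.eigenvalues q| ^ 2)) := by
        rw [Finset.sum_sub_distrib, ← Finset.mul_sum]
        simp

end IsExpectation

end

/-- dᵀ R² d = |R d|² for symmetric R; with R² = F_Q⁻¹ it trades the weight for the normalised
operators. -/
theorem sum_sum_mul_self_apply {n : ℕ} {R : Matrix (Fin n) (Fin n) ℝ} (hR : R.transpose = R)
    (d : Fin n → ℝ) :
    ∑ j, ∑ k, (R * R) j k * (d k * d j) = ∑ j, (∑ k, R j k * d k) ^ 2 := by
  have hs (j l : Fin n) : R j l = R l j := congrFun (congrFun hR l) j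
  have e (j : Fin n) : ∑ k, (R * R) j k * (d k * d j) =
      ∑ l, ∑ k, R l j * d j * (R l k * d k) := by
    simp only [Matrix.mul_apply, Finset.sum_mul]
    rw [Finset.sum_comm]
    refine Finset.sum_congr rfl fun l _ => Finset.sum_congr rfl fun k _ => ?_
    rw [hs j l]
    ring
  simp only [e]
  rw [Finset.sum_comm]
  refine Finset.sum_congr rfl fun l _ => ?_
  rw [sq, Finset.sum_mul_sum]

/-! ### The classical Fisher information. -/

section

variable {H : Type*} [NormedAddCommGroup H] [InnerProductSpace ℂ H] [CompleteSpace H] {n : ℕ}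

namespace IsExpectation

variable {ρ : (Fin n → ℝ) → H →L[ℂ] H} {x : Fin n → ℝ} {φ : (H →L[ℂ] H) →ₗ[ℂ] ℂ}
  (hφ : IsExpectation (ρ x) φ)
include hφ

/-- The weak derivative is (φ(L M_m) + φ(M_m L)) / 2, and the two terms are complex conjugates. -/
theorem lineDeriv_prob {j : Fin n} {L : H →L[ℂ] H} (hL : IsSLD ρ x j L) {ι : Type*} (M : POVM ι H)
    (m : ι) : lineDeriv ℝ (prob ρ M m) x (Pi.single j 1) = (φ (M.effect m * L)).re := by
  set A := M.effect m
  have hA : star A = A := (M.isPositive m).isSelfAdjoint.star_eq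
  have htr : trace (A * ((1 / 2 : ℂ) • (ρ x * L + L * ρ x))) =
      (1 / 2 : ℂ) * (φ (L * A) + φ (A * L)) := by
    have h := ((hφ.hasSum A L).add (hφ.hasSum (A * L) 1)).mul_left (1 / 2 : ℂ)
    rw [one_mul] at h
    rw [← h.tsum_eq, trace]
    refine tsum_congr fun i => ?_
    rw [mul_smul_comm, mul_add, _root_.smul_apply, _root_.add_apply, inner_smul_right,
      inner_add_right, mul_one, mul_assoc, mul_assoc]
  have hconj : φ (L * A) = conj (φ (A * L)) := by
    rw [← hφ.map_star, star_mul, hA, hL.isSelfAdjoint.star_eq]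
  have h := hL.hasLineDerivAt A
  rw [htr, hconj] at h
  have h' : HasLineDerivAt ℝ (prob ρ M m) _ x (Pi.single j 1) :=
    Complex.reCLM.hasFDerivAt.comp_hasDerivAt _ h
  rw [h'.lineDeriv]
  simp
  ring

theorem cfimTerm_eq {L : Fin n → H →L[ℂ] H} (hL : ∀ j, IsSLD ρ x j (L j)) {ι : Type*}
    (M : POVM ι H) (j k : Fin n) (m : ι) :
    cfimTerm ρ x M j k m = (φ (M.effect m * L j)).re * (φ (M.effect m * L k)).re /
      (φ (M.effect m)).re := by
  rw [cfimTerm, hφ.lineDeriv_prob (hL j), hφ.lineDeriv_prob (hL k), prob, hφ.trace_mul_left]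

/-- By |ab| ≤ a² + b², the two diagonal series dominate, and these are bounded by the Cauchy–Schwarz
estimate with X = L_j and X = L_k. -/
theorem summable_cfimTerm {L : Fin n → H →L[ℂ] H} (hL : ∀ j, IsSLD ρ x j (L j)) {ι : Type*}
    (M : POVM ι H) (j k : Fin n) : Summable (cfimTerm ρ x M j k) := by
  have hp (m : ι) : 0 ≤ (φ (M.effect m)).re := hφ.re_nonneg _ (M.isPositive m)
  have hsq (j : Fin n) :
      Summable fun m => ‖φ (M.effect m * L j)‖ ^ 2 / (φ (M.effect m)).re :=
    summable_of_sum_le (fun m => div_nonneg (sq_nonneg _) (hp m))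
      (hφ.sum_norm_map_effect_mul_sq_div_le M (L j))
  refine Summable.of_norm_bounded ((hsq j).add (hsq k)) fun m => ?_
  rw [hφ.cfimTerm_eq hL, norm_div, norm_mul, Real.norm_of_nonneg (hp m), ← add_div]
  refine div_le_div_of_nonneg_right ?_ (hp m)
  have h := mul_le_mul (Complex.abs_re_le_norm (φ (M.effect m * L j)))
    (Complex.abs_re_le_norm (φ (M.effect m * L k))) (abs_nonneg _) (norm_nonneg _)
  rw [Real.norm_eq_abs, Real.norm_eq_abs]
  nlinarith [sq_nonneg (‖φ (M.effect m * L j)‖ - ‖φ (M.effect m * L k)‖),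
    sq_nonneg ‖φ (M.effect m * L j)‖, sq_nonneg ‖φ (M.effect m * L k)‖]

/-- Convergence of each entry lets the trace be taken outcome by outcome, so a bound on all finite
sets of outcomes passes to the limit. -/
theorem trace_mul_cfim_le {L : Fin n → H →L[ℂ] H} (hL : ∀ j, IsSLD ρ x j (L j)) {ι : Type*}
    (M : POVM ι H) (W : Matrix (Fin n) (Fin n) ℝ) {c : ℝ}
    (h : ∀ s : Finset ι, ∑ m ∈ s, (∑ j, ∑ k, W j k * ((φ (M.effect m * L k)).re *
      (φ (M.effect m * L j)).re)) / (φ (M.effect m)).re ≤ c) :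
    (W * cfim ρ x M).trace ≤ c := by
  have hs : HasSum (fun m => ∑ j, ∑ k, W j k * cfimTerm ρ x M k j m) (W * cfim ρ x M).trace := by
    simp only [Matrix.trace, Matrix.diag_apply, Matrix.mul_apply, cfim, Matrix.of_apply]
    exact hasSum_sum fun j _ => hasSum_sum fun k _ =>
      (hφ.summable_cfimTerm hL M k j).hasSum.mul_left _
  refine hasSum_le_of_sum_le hs fun s => le_of_eq_of_le ?_ (h s)
  refine Finset.sum_congr rfl fun m _ => ?_
  simp only [Finset.sum_div, hφ.cfimTerm_eq hL, mul_div_assoc]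

end IsExpectation

end

end QEst

/-! ### The main theorem. -/

theorem theorem1 {H : Type*} [NormedAddCommGroup H] [InnerProductSpace ℂ H] [CompleteSpace H]
    {n : ℕ} (ρ : (Fin n → ℝ) → H →L[ℂ] H) (x : Fin n → ℝ)
    (hρ : ∀ᶠ y in 𝓝 x, QEst.IsDensityOperator (ρ y))
    (L : Fin n → H →L[ℂ] H) (hL : ∀ j, QEst.IsSLD ρ x j (L j))
    (hF : IsUnit (QEst.qfim (ρ x) L))
    (ev : Fin n → ℂ)
    (hev : Finset.univ.val.map ev =
      ((QEst.normalizedIm (ρ x) L).map Complex.ofReal).charpoly.roots) :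
    (∀ q, ‖ev q‖ ≤ 1) ∧
    (∀ (ι : Type) (M : QEst.POVM ι H) (j k : Fin n), Summable (QEst.cfimTerm ρ x M j k)) ∧
    BddAbove (QEst.weightedInfoValues ρ x L) ∧
    QEst.maxWeightedInfo ρ x L ≤ n - 1 / 2 * ∑ q, (1 - √(1 - ‖ev q‖ ^ 2)) := by
  obtain ⟨φ, hφ⟩ := hρ.self_of_nhds.exists_isExpectation
  have hLs (j : Fin n) : IsSelfAdjoint (L j) := (hL j).isSelfAdjoint
  set F := QEst.qfim (ρ x) L with hFdef
  set R := QEst.invSqrt F with hR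
  have hRT : R.transpose = R := QEst.transpose_invSqrt F
  have hRR : R * R = F⁻¹ := QEst.invSqrt_mul_invSqrt (hφ.posSemidef_qfim hLs) hF
  have hRFR : R * F * R = 1 := by
    rw [mul_eq_one_comm, ← mul_assoc, hRR]
    exact Matrix.nonsing_inv_mul F ((Matrix.isUnit_iff_isUnit_det F).1 hF)
  set A := QEst.normalizedIm (ρ x) L with hAdef
  have hAT : A.transpose = -A := by
    simp only [hAdef, QEst.normalizedIm, ← hFdef, ← hR, Matrix.transpose_mul, hRT,
      hφ.transpose_geomIm hLs]
    simp [mul_assoc]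
  have hH : (Complex.I • A.map Complex.ofReal).IsHermitian := by
    ext j k
    have := congrFun (congrFun hAT j) k
    simp only [Matrix.transpose_apply, Matrix.neg_apply] at this
    simp [this]
  set K : Fin n → H →L[ℂ] H := fun j => ∑ k, (R j k : ℂ) • L k with hK
  have hKs (j : Fin n) : IsSelfAdjoint (K j) :=
    isSelfAdjoint_sum _ fun k _ => IsSelfAdjoint.smul (Complex.conj_ofReal _) (hLs k)
  have hKA (j k : Fin n) : φ (K j * K k) = (1 + Complex.I • A.map Complex.ofReal) j k := by
    rw [hK, hφ.map_sum_smul_mul_sum_smul hLs R j k, hRT, hRFR]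
    simp [Matrix.one_apply, apply_ite, hAdef, QEst.normalizedIm, ← hFdef, ← hR]
  obtain ⟨habs, hbound⟩ := hφ.sum_sum_sq_div_le hKs hH hKA
  have hmap := QEst.map_norm_eq_of_map_eq_roots hH hev
  -- `ev` and the eigenvalues of iA are matched only as multisets of moduli, so the index may
  -- change.
  have hev1 (q : Fin n) : ‖ev q‖ ≤ 1 := by
    have hq : ‖ev q‖ ∈ Finset.univ.val.map fun q => ‖ev q‖ :=
      Multiset.mem_map_of_mem _ (Finset.mem_univ_val q)
    rw [hmap] at hq
    obtain ⟨q', -, h⟩ := Multiset.mem_map.1 hq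
    exact h ▸ habs q'
  have hsum : ∑ q, (1 - √(1 - |hH.eigenvalues q| ^ 2)) = ∑ q, (1 - √(1 - ‖ev q‖ ^ 2)) := by
    have := congrArg (fun t => (t.map fun r : ℝ => 1 - √(1 - r ^ 2)).sum) hmap
    simp only [Multiset.map_map, Function.comp_def] at this
    exact this.symm
  have hle : ∀ g ∈ QEst.weightedInfoValues ρ x L,
      g ≤ n - 1 / 2 * ∑ q, (1 - √(1 - ‖ev q‖ ^ 2)) := by
    rintro g ⟨ι, M, rfl⟩
    rw [← hsum]
    refine hφ.trace_mul_cfim_le hL M _ fun s => le_of_eq_of_le ?_ (hbound M s)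
    refine Finset.sum_congr rfl fun m _ => congrArg (· / _) ?_
    have hre (j : Fin n) : (φ (M.effect m * K j)).re = ∑ k, R j k * (φ (M.effect m * L k)).re := by
      simp [hK, Finset.mul_sum, map_sum]
    simp only [hre]
    rw [← hFdef, ← hRR, QEst.sum_sum_mul_self_apply hRT]
  -- `Real.sSup_le` also requires the bound to be nonnegative; it is at least n / 2, each summand
  -- being at most 1.
  refine ⟨hev1, fun ι M j k => hφ.summable_cfimTerm hL M j k, ⟨_, hle⟩, Real.sSup_le hle ?_⟩
  have : ∑ q, (1 - √(1 - ‖ev q‖ ^ 2)) ≤ ∑ _q : Fin n, (1 : ℝ) :=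
    Finset.sum_le_sum fun q _ => by linarith [Real.sqrt_nonneg (1 - ‖ev q‖ ^ 2)]
  rw [Finset.sum_const, Finset.card_univ, Fintype.card_fin, nsmul_one] at this
  have hn : (0 : ℝ) ≤ n := n.cast_nonneg
  linarith
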